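/- Let $n>1$ be an integer and let $p_1,\dots,p_n$ be distinct primes; put $p_{n+1}=p_1$ and $x_{n+1}=x_1$. A left brace is a set $B$ with operations $+,\circ$ such that $(B,+)$ is an abelian group, $(B,\circ)$ is a group and $a\circ(b+c)+a=a\circ b+a\circ c$ for all $a,b,c\in B$. Its lambda map is the action $\lambda\colon(B,\circ)\to\operatorname{Aut}(B,+)$, $\lambda_a(b)=-a+a\circ b$. An ideal of $B$ is a normal subgroup of $(B,\circ)$ that is invariant under all $\lambda_a$; $B$ is simple if $B\neq\{0\}$ and its only ideals are $\{0\}$ and $B$; $B$ is trivial if $a\circ b=a+b$ for all $a,b\in B$. A solution of the Yang--Baxter equation means an involutive, non-degenerate, set-theoretic solution $(X,r)$, $X\ne\emptyset$; it is simple if $|X|>1$ and every epimorphism of solutions $(X,r)\to(Y,s)$ is an isomorphism or satisfies $|Y|=1$. Given abelian groups $T,H$, a homomorphism $\alpha\colon H\to\operatorname{Aut}(T)$ and a symmetric bi-additive map $b\colon T\times T\to H$ with $b(\alpha(x)u,\alpha(x)v)=b(u,v)$ for all $x\in H$ and $u,v\in T$, the asymmetric product $T\rtimes_\circ H$ of the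 trivial braces $T$ and $H$ is the left brace on $T\times H$ with $$(u,x)+(v,y)=(u+v,\;x+y+b(u,v)),\qquad (u,x)\circ(v,y)=(u+\alpha(x)v,\;x+y).$$ Let $T=\prod_{j=1}^n(\mathbb Z/(p_j))^{p_{j+1}-1}$ and $H=\prod_{j=1}^n\mathbb Z/(p_j)$. For each $j$ let $C_j,B_j\in M_{p_{j+1}-1}(\mathbb Z/(p_j))$, where $C_j$ has all entries of its last column equal to $-1$, in the other columns entries $1$ immediately below the diagonal, and $0$ elsewhere, and where $B_j$ has diagonal entries $1-p_{j+1}$ and all other entries $1$. Then $$\alpha(x_1,\dots,x_n)(u_1,\dots,u_n)=\bigl(u_j(C_j^{x_{j+1}})^t\bigr)_{1\le j\le n},\qquad b(u,v)=\bigl(u_jB_jv_j^t\bigr)_{1\le j\le n}$$ are well defined and satisfy the above conditions, and the asymmetric product $B=T\rtimes_\circ H$ is a finite, non-trivial, simple left brace of order $$|B|=p_1^{p_2}\cdots p_{n-1}^{p_n}p_n^{p_1}.$$ Moreover, there is an orbit $X$ of the lambda map of $B$ that generates the additive group $(B,+)$ and has $|X|=p_1^2\cdots p_n^2$, and $(X,r)$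 with $r(x,y)=(\lambda_x(y),\lambda_{\lambda_x(y)}^{-1}(x))$ is a simple solution of the Yang--Baxter equation. -/

import Mathlib

/-- A left brace: an abelian group `(B, +)` and a group `(B, *)` on the same set, with
`a * (b + c) + a = a * b + a * c`. (The multiplication `*` is the operation usually written `∘`.) -/
class LeftBrace (B : Type*) extends AddCommGroup B, Group B where
  mul_add_add : ∀ a b c : B, a * (b + c) + a = a * b + a * c

namespace LeftBrace

variable {B : Type*} [LeftBrace B]

theorem mul_zero_eq (a : B) : a * (0 : B) = a := by
  have h := mul_add_add a (0 : B) 0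
  rw [add_zero] at h
  exact (add_left_cancel h).symm

theorem lam_mul (a b c : B) : -(a * b) + a * b * c = -a + a * (-b + b * c) := by
  have h1 := mul_add_add a b (-b + b * c)
  rw [add_neg_cancel_left, ← mul_assoc] at h1
  have h2 : a * (-b + b * c) = -(a * b) + (a * b * c + a) := by rw [h1]; abel
  rw [h2]; abel

/-- The automorphism `lambda a` of `(B, +)`, `lambda a b = -a + a * b`. -/
def lambda (a : B) : B ≃+ B where
  toFun b := -a + a * b
  invFun b := -a⁻¹ + a⁻¹ * b
  left_inv b := by
    have h : (1 : B) = 0 := by rw [← mul_zero_eq (1 : B), one_mul]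
    beta_reduce
    rw [← lam_mul a⁻¹ a b, inv_mul_cancel, one_mul, h, neg_zero, zero_add]
  right_inv b := by
    have h : (1 : B) = 0 := by rw [← mul_zero_eq (1 : B), one_mul]
    beta_reduce
    rw [← lam_mul a a⁻¹ b, mul_inv_cancel, one_mul, h, neg_zero, zero_add]
  map_add' b c := by
    have h : a * (b + c) = a * b + a * c - a := eq_sub_of_add_eq (mul_add_add a b c)
    rw [h]; abel

theorem lambda_apply (a b : B) : lambda a b = -a + a * b := rfl

/-- A trivial brace: the two operations coincide. -/
def IsTrivial (B : Type*) [LeftBrace B] : Prop :=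
  ∀ a b : B, a * b = a + b

/-- An ideal: a normal subgroup of the multiplicative group that is invariant under all the
maps `lambda a`. -/
def IsIdeal (I : Subgroup B) : Prop :=
  I.Normal ∧ ∀ a : B, ∀ b ∈ I, lambda a b ∈ I

/-- A simple left brace: a nonzero left brace whose only ideals are zero and the whole brace. -/
def IsSimple (B : Type*) [LeftBrace B] : Prop :=
  Nontrivial B ∧ ∀ I : Subgroup B, IsIdeal I → I = ⊥ ∨ I = ⊤

/-- The orbit of `x` under the action of the lambda map. -/
def lambdaOrbit (x : B) : Set B :=
  {y | ∃ a : B, lambda a x = y}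

theorem lambda_mem_lambdaOrbit {x y : B} (a : B) (hy : y ∈ lambdaOrbit x) :
    lambda a y ∈ lambdaOrbit x := by
  obtain ⟨c, rfl⟩ := hy
  exact ⟨a * c, lam_mul a c x⟩

theorem lambda_inv_mem_lambdaOrbit {x y : B} (a : B) (hy : y ∈ lambdaOrbit x) :
    (lambda a).symm y ∈ lambdaOrbit x := by
  exact lambda_mem_lambdaOrbit a⁻¹ hy

/-- The map `r (y, z) = (λ_y z, λ_{λ_y z}⁻¹ y)` on a lambda-orbit. -/
def orbitMap (x : B) (q : lambdaOrbit x × lambdaOrbit x) : lambdaOrbit x × lambdaOrbit x :=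
  (⟨lambda (q.1 : B) (q.2 : B), lambda_mem_lambdaOrbit _ q.2.2⟩,
    ⟨(lambda (lambda (q.1 : B) (q.2 : B))).symm (q.1 : B), lambda_inv_mem_lambdaOrbit _ q.1.2⟩)

end LeftBrace

universe u

namespace YangBaxter

/-- `r × id` on triples. -/
def r12 {X : Type*} (r : X × X → X × X) (t : X × X × X) : X × X × X :=
  ((r (t.1, t.2.1)).1, (r (t.1, t.2.1)).2, t.2.2)

/-- `id × r` on triples. -/
def r23 {X : Type*} (r : X × X → X × X) (t : X × X × X) : X × X × X :=
  (t.1, r t.2)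

/-- An involutive, non-degenerate, set-theoretic solution of the Yang-Baxter equation.
With `r (x, y) = (σ_x y, γ_y x)`, all the maps `σ_x` and `γ_y` are bijective. -/
structure IsSolution {X : Type*} (r : X × X → X × X) : Prop where
  nonempty : Nonempty X
  involutive : ∀ q, r (r q) = q
  bijective_sigma : ∀ x, Function.Bijective fun y => (r (x, y)).1
  bijective_gamma : ∀ y, Function.Bijective fun x => (r (x, y)).2
  braid : r12 r ∘ r23 r ∘ r12 r = r23 r ∘ r12 r ∘ r23 r

/-- A homomorphism of solutions:
`f (σ_x y) = σ'_{f x} (f y)` and `f (γ_y x) = γ'_{f y} (f x)`. -/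
def IsHom {X Y : Type*} (r : X × X → X × X) (s : Y × Y → Y × Y) (f : X → Y) : Prop :=
  ∀ x y, f (r (x, y)).1 = (s (f x, f y)).1 ∧ f (r (x, y)).2 = (s (f x, f y)).2

/-- A simple solution: a solution with more than one element such that every epimorphism of
solutions onto a solution `(Y, s)` is an isomorphism or has `|Y| = 1`. An epimorphic image of
`X` lives, up to isomorphism, in the universe of `X`. -/
def IsSimpleSolution {X : Type u} (r : X × X → X × X) : Prop :=
  IsSolution r ∧ Nontrivial X ∧
    ∀ (Y : Type u) (s : Y × Y → Y × Y), IsSolution s →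
      ∀ f : X → Y, IsHom r s f → Function.Surjective f →
        Function.Bijective f ∨ Nat.card Y = 1

end YangBaxter

/-- The data defining an asymmetric product of two trivial braces, that is, of two abelian groups
`T` and `H`: an action of `H` on `T` by automorphisms and an invariant symmetric
bi-additive map `T × T → H`. -/
structure AsymmetricData (T H : Type*) [AddCommGroup T] [AddCommGroup H] where
  /-- `AddAut T` is an additive group, with composition as its addition. -/
  act : H →+ AddAut T
  form : T →+ T →+ H
  form_symm : ∀ u v, form u v = form v u
  form_act : ∀ x u v, form (act x u) (act x v) = form u v

/-- The underlying set `T × H` of the asymmetric product. -/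
@[ext]
structure AsymmetricProduct {T H : Type*} [AddCommGroup T] [AddCommGroup H]
    (D : AsymmetricData T H) where
  fst : T
  snd : H

namespace AsymmetricProduct

variable {T H : Type*} [AddCommGroup T] [AddCommGroup H] {D : AsymmetricData T H}

/-- `(u, x) + (v, y) = (u + v, x + y + b (u, v))`. -/
instance : Add (AsymmetricProduct D) :=
  ⟨fun a c => ⟨a.fst + c.fst, a.snd + c.snd + D.form a.fst c.fst⟩⟩

instance : Zero (AsymmetricProduct D) := ⟨⟨0, 0⟩⟩

instance : Neg (AsymmetricProduct D) :=
  ⟨fun a => ⟨-a.fst, -a.snd + D.form a.fst a.fst⟩⟩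

/-- `(u, x) * (v, y) = (u + α_x v, x + y)`, the semidirect product. -/
instance : Mul (AsymmetricProduct D) :=
  ⟨fun a c => ⟨a.fst + D.act a.snd c.fst, a.snd + c.snd⟩⟩

instance : One (AsymmetricProduct D) := ⟨⟨0, 0⟩⟩

instance : Inv (AsymmetricProduct D) :=
  ⟨fun a => ⟨-D.act (-a.snd) a.fst, -a.snd⟩⟩

theorem add_def (a c : AsymmetricProduct D) :
    a + c = ⟨a.fst + c.fst, a.snd + c.snd + D.form a.fst c.fst⟩ := rfl

theorem zero_def : (0 : AsymmetricProduct D) = ⟨0, 0⟩ := rfl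

theorem neg_def (a : AsymmetricProduct D) :
    -a = ⟨-a.fst, -a.snd + D.form a.fst a.fst⟩ := rfl

theorem mul_def (a c : AsymmetricProduct D) :
    a * c = ⟨a.fst + D.act a.snd c.fst, a.snd + c.snd⟩ := rfl

theorem one_def : (1 : AsymmetricProduct D) = ⟨0, 0⟩ := rfl

theorem inv_def (a : AsymmetricProduct D) :
    a⁻¹ = ⟨-D.act (-a.snd) a.fst, -a.snd⟩ := rfl

instance : AddCommGroup (AsymmetricProduct D) where
  add_assoc a c d := by
    simp only [add_def, map_add, AddMonoidHom.add_apply]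
    ext
    · exact add_assoc _ _ _
    · dsimp only; abel
  zero_add a := by simp [add_def, zero_def]
  add_zero a := by simp [add_def, zero_def]
  neg_add_cancel a := by simp [add_def, zero_def, neg_def]
  add_comm a c := by
    simp only [add_def, D.form_symm a.fst c.fst, add_comm a.fst, add_comm a.snd]
  nsmul := nsmulRec
  zsmul := zsmulRec

instance : Group (AsymmetricProduct D) where
  mul_assoc a c d := by
    simp [mul_def, add_assoc]
  one_mul a := by simp [mul_def, one_def]
  mul_one a := by simp [mul_def, one_def]
  inv_mul_cancel a := by simp [mul_def, one_def, inv_def]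

/-- The asymmetric product `T ⋊_∘ H` of the trivial braces `T` and `H`. -/
instance : LeftBrace (AsymmetricProduct D) where
  mul_add_add a c d := by
    simp only [add_def, mul_def, map_add, AddMonoidHom.add_apply, D.form_act,
      D.form_symm (D.act a.snd c.fst) a.fst,
      D.form_symm (D.act a.snd d.fst) a.fst]
    ext
    · dsimp only; abel
    · dsimp only; abel

end AsymmetricProduct

namespace CyclicConstruction

/-- The matrix of size `q - 1` with `1` below the diagonal, `-1` in the whole last column, and `0`
elsewhere. -/
def matC (R : Type*) [CommRing R] (q : ℕ) : Matrix (Fin (q - 1)) (Fin (q - 1)) R :=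
  fun i j => if (j : ℕ) + 1 = q - 1 then -1 else if (i : ℕ) = (j : ℕ) + 1 then 1 else 0

/-- The matrix of size `q - 1` with `1 - q` on the diagonal and `1` elsewhere. -/
def matB (R : Type*) [CommRing R] (q : ℕ) : Matrix (Fin (q - 1)) (Fin (q - 1)) R :=
  fun i j => if i = j then 1 - (q : R) else 1

/-- The group `(ℤ/p_1)^(p_2 - 1) × ⋯ × (ℤ/p_(n-1))^(p_n - 1) × (ℤ/p_n)^(p_1 - 1)`;
`finRotate n i` is the cyclic successor of `i`. -/
abbrev T {n : ℕ} (p : Fin n → ℕ) : Type :=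
  ∀ i : Fin n, Fin (p (finRotate n i) - 1) → ZMod (p i)

/-- The group `ℤ/p_1 × ⋯ × ℤ/p_n`. -/
abbrev H {n : ℕ} (p : Fin n → ℕ) : Type :=
  ∀ i : Fin n, ZMod (p i)

end CyclicConstruction

/-! ### Identities in left braces: the two actions `lambda` and `rho` -/

namespace LeftBrace

variable {B : Type*} [LeftBrace B]

/-! Write `q` for the prime following `p i`. Extending vectors of length `q - 1` by `0` at `-1`
identifies them with functions on `ZMod q` modulo constants. There `matC` is the cyclic shift, and
`matB` gives `(∑ v) (∑ w) - q ∑ v w`, which ignores both shifts and constants; this is the required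
invariance. Distinctness of the primes makes `q` invertible mod `p i`, so the form is nondegenerate
(`bform_surjective`) and a nonzero shift fixes only `0` (`eq_zero_of_shift_eq`).

For a nonzero ideal, the form turns a nonzero `i`-th component in `T` into the whole factor `i` of
`H`, and commutators turn factor `i + 1` of `H` into factor `i` of `T`. Going around the cycle fills
the brace.

The orbit of `(v, 0)` with all `v i ≠ 0` consists of all `(α(x) v, y)`, hence has `|H|²` elements;
for `v` all ones it generates additively. A generating orbit of a finite simple brace gives a simple
solution (`orbitMap_isSimpleSolution`): differences of points in a common fibre of an epimorphism
generate an ideal. -/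

theorem one_eq_zero : (1 : B) = 0 := by
  rw [← mul_zero_eq (1 : B), one_mul]

theorem mul_eq_add_lambda (a b : B) : a * b = a + lambda a b := by
  rw [lambda_apply, add_neg_cancel_left]

theorem lambda_mul (a b c : B) : lambda (a * b) c = lambda a (lambda b c) :=
  lam_mul a b c

theorem lambda_one (b : B) : lambda (1 : B) b = b := by
  rw [lambda_apply, one_mul, one_eq_zero, neg_zero, zero_add]

theorem lambda_inv_lambda (a b : B) : lambda a⁻¹ (lambda a b) = b :=
  (lambda a).symm_apply_apply b

theorem lambda_lambda_inv (a b : B) : lambda a (lambda a⁻¹ b) = b :=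
  (lambda a).apply_symm_apply b

theorem lambda_inv_self (a : B) : lambda a⁻¹ a = -a⁻¹ := by
  rw [lambda_apply, inv_mul_cancel, one_eq_zero, add_zero]

theorem lambda_neg_inv_neg (a : B) : lambda (-a)⁻¹ a = (-a)⁻¹ := by
  have h := lambda_inv_self (-a)
  rw [map_neg] at h
  exact neg_injective h

theorem add_eq_mul_lambda (a b : B) : a + b = a * lambda a⁻¹ b := by
  rw [mul_eq_add_lambda, lambda_lambda_inv]

/-- A multiplicative subgroup containing a `lambda`-invariant set contains the additive subgroup
generated by this set. -/
theorem addClosure_subset_subgroup {S : Subgroup B} {W : Set B}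
    (hW : ∀ a, ∀ w ∈ W, lambda a w ∈ W) (hS : ∀ w ∈ W, w ∈ S) {g : B}
    (hg : g ∈ AddSubgroup.closure W) : g ∈ S := by
  -- Quantifying over `a` makes the induction work: `g + h = g * lambda g⁻¹ h` twists the second
  -- summand.
  suffices h : ∀ a, lambda a g ∈ S by simpa [lambda_one] using h 1
  induction hg using AddSubgroup.closure_induction with
  | mem w hw => exact fun a => hS _ (hW a w hw)
  | zero => intro a; rw [map_zero, ← one_eq_zero]; exact S.one_mem
  | add g h _ _ ihg ihh =>
    intro a
    rw [map_add, add_eq_mul_lambda, ← lambda_mul]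
    exact S.mul_mem (ihg a) (ihh _)
  | neg g _ ih =>
    intro a
    rw [map_neg, ← inv_inv (-lambda a g), ← lambda_neg_inv_neg, ← lambda_mul]
    exact S.inv_mem (ih _)

/-- The right action `rho b a = (λ_a b)⁻¹ * a * b` of a left brace on itself. -/
def rho (b a : B) : B := (lambda (lambda a b)).symm a

theorem lambda_mul_rho (a b : B) : lambda a b * rho b a = a * b := by
  rw [mul_eq_add_lambda, mul_eq_add_lambda a b, rho, AddEquiv.apply_symm_apply, add_comm]

theorem inv_mul_lambda (a b : B) : a⁻¹ * lambda a b = a⁻¹ + b := by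
  rw [mul_eq_add_lambda, lambda_inv_lambda]

theorem inv_rho (a b : B) : (rho b a)⁻¹ = b⁻¹ * (a⁻¹ + b) := by
  have h : rho b a = (lambda a b)⁻¹ * (a * b) := by
    rw [← lambda_mul_rho a b, inv_mul_cancel_left]
  rw [h, ← inv_mul_lambda]
  group

/-- After inversion `rho b` is `a⁻¹ ↦ b⁻¹ * (a⁻¹ + b)`, and the brace axiom composes these maps. -/
theorem rho_rho (a b c : B) : rho c (rho b a) = rho (b * c) a := by
  apply inv_injective
  rw [inv_rho, inv_rho, inv_rho, mul_inv_rev, mul_assoc]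
  congr 1
  have h₁ := mul_add_add b⁻¹ a⁻¹ b
  have h₂ := mul_add_add b⁻¹ a⁻¹ (b * c)
  rw [inv_mul_cancel, one_eq_zero, add_zero] at h₁
  rw [inv_mul_cancel_left, ← h₁] at h₂
  exact add_right_cancel (b := b⁻¹) (by rw [h₂]; abel)

theorem rho_injective (b : B) : Function.Injective (rho b) := by
  intro a c h
  have h' := congrArg (·⁻¹) h
  simp only [inv_rho] at h'
  exact inv_injective (add_right_cancel (mul_left_cancel h'))

/-! ### Solutions on lambda-orbits and their simplicity -/

open YangBaxter

/-- The outer entries agree because `lambda` is a left and `rho` a right action. Both sides preserve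
the product of the three entries, so cancellation gives the middle one. -/
theorem orbitMap_braid (x : B) :
    r12 (orbitMap x) ∘ r23 (orbitMap x) ∘ r12 (orbitMap x) =
      r23 (orbitMap x) ∘ r12 (orbitMap x) ∘ r23 (orbitMap x) := by
  funext ⟨a, b, c⟩
  have h₁ : lambda (lambda (a : B) b) (lambda (rho (b : B) a) c) =
      lambda (a : B) (lambda (b : B) c) := by
    rw [← lambda_mul, lambda_mul_rho, lambda_mul]
  have h₃ : rho (c : B) (rho (b : B) a) = rho (rho (c : B) b) (rho (lambda (b : B) c) (a : B)) := by
    rw [rho_rho, rho_rho, lambda_mul_rho]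
  have h₂ : rho (lambda (rho (b : B) a) c) (lambda (a : B) b) =
      lambda (rho (lambda (b : B) c) (a : B)) (rho (c : B) b) := by
    have e₁ : lambda (lambda (a : B) b) (lambda (rho (b : B) a) c) *
        rho (lambda (rho (b : B) a) c) (lambda (a : B) b) * rho (c : B) (rho (b : B) a) =
          a * b * c := by
      rw [lambda_mul_rho, mul_assoc, lambda_mul_rho, ← mul_assoc, lambda_mul_rho]
    have e₂ : lambda (a : B) (lambda (b : B) c) *
        lambda (rho (lambda (b : B) c) (a : B)) (rho (c : B) b) *
          rho (rho (c : B) b) (rho (lambda (b : B) c) (a : B)) = a * b * c := by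
      rw [mul_assoc, lambda_mul_rho, ← mul_assoc, lambda_mul_rho, mul_assoc, lambda_mul_rho,
        ← mul_assoc]
    rw [h₁, h₃, ← e₂] at e₁
    exact mul_left_cancel (mul_right_cancel e₁)
  exact Prod.ext (Subtype.ext h₁) (Prod.ext (Subtype.ext h₂) (Subtype.ext h₃))

theorem self_mem_lambdaOrbit (x : B) : x ∈ lambdaOrbit x := ⟨1, lambda_one x⟩

theorem orbitMap_isSolution (x : B) [Finite (lambdaOrbit x)] : IsSolution (orbitMap x) where
  nonempty := ⟨⟨x, self_mem_lambdaOrbit x⟩⟩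
  involutive := by
    rintro ⟨a, b⟩
    have h₁ : lambda (lambda (a : B) b) (rho (b : B) a) = a := by
      rw [rho, AddEquiv.apply_symm_apply]
    refine Prod.ext (Subtype.ext h₁) (Subtype.ext ?_)
    change (lambda (lambda (lambda (a : B) b) (rho (b : B) a))).symm (lambda (a : B) b) = b
    rw [h₁, AddEquiv.symm_apply_apply]
  bijective_sigma a := Finite.injective_iff_bijective.mp fun b c h =>
    Subtype.ext ((lambda (a : B)).injective (congrArg Subtype.val h))
  bijective_gamma b := Finite.injective_iff_bijective.mp fun a c h =>
    Subtype.ext (rho_injective (b : B) (congrArg Subtype.val h))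
  braid := orbitMap_braid x

/-- An additive subgroup invariant under the lambda map is closed under multiplication, so it is a
subgroup of the multiplicative group. -/
def subgroupOfInvariant (I : AddSubgroup B) (hI : ∀ a, ∀ b ∈ I, lambda a b ∈ I) : Subgroup B where
  carrier := I
  mul_mem' {a b} ha hb := by
    rw [mul_eq_add_lambda]
    exact I.add_mem ha (hI a b hb)
  one_mem' := by
    rw [one_eq_zero]
    exact I.zero_mem
  inv_mem' {a} ha := by
    rw [← neg_neg a⁻¹, ← lambda_inv_self]
    exact I.neg_mem (hI _ _ ha)

/-- Reduces normality of a `lambda`-invariant additive subgroup to containing all `lambda g c - c`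
with `g` in it. -/
theorem conj_eq (a g : B) :
    a * g * a⁻¹ = lambda a g - lambda a (lambda g (lambda a⁻¹ a) - lambda a⁻¹ a) := by
  have h : lambda a a⁻¹ = -a := by
    have := lambda_inv_self a⁻¹
    rwa [inv_inv] at this
  rw [lambda_inv_self, map_neg, map_sub, map_neg, map_neg, h, mul_eq_add_lambda (a * g),
    lambda_mul, mul_eq_add_lambda a g]
  abel

theorem orbitMap_isSimpleSolution [Finite B] (hB : IsSimple B) (x : B)
    (hgen : AddSubgroup.closure (lambdaOrbit x) = ⊤) (hnt : Nontrivial (lambdaOrbit x)) :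
    IsSimpleSolution (orbitMap x) := by
  refine ⟨orbitMap_isSolution x, hnt, fun Y s hs f hf hsurj => ?_⟩
  let act (a : B) (y : lambdaOrbit x) : lambdaOrbit x :=
    ⟨lambda a (y : B), lambda_mem_lambdaOrbit a y.2⟩
  have act_mul (a b : B) (y) : act (a * b) y = act a (act b y) := Subtype.ext (lambda_mul a b y)
  have act_one (y) : act 1 y = y := Subtype.ext (lambda_one y.1)
  have act_inv_act (a : B) (y) : act a⁻¹ (act a y) = y := Subtype.ext (lambda_inv_lambda a y)
  have act_act_inv (a : B) (y) : act a (act a⁻¹ y) = y := Subtype.ext (lambda_lambda_inv a y)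
  have f_act (y z : lambdaOrbit x) : f (act y z) = (s (f y, f z)).1 := (hf y z).1
  -- the multiplicative group respects the fibres of `f`
  let S : Subgroup B :=
    { carrier := {a | ∀ y z, f (act a y) = f (act a z) ↔ f y = f z}
      mul_mem' := fun {a b} ha hb y z => by rw [act_mul, act_mul, ha, hb]
      one_mem' := fun y z => by rw [act_one, act_one]
      inv_mem' := fun {a} ha y z => by rw [← ha, act_act_inv, act_act_inv] }
  -- Orbit elements lie in `S` because the maps `σ` of `Y` are injective; the orbit generates `B`.
  have hS (a : B) (y z) : f (act a y) = f (act a z) ↔ f y = f z := by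
    refine addClosure_subset_subgroup (S := S) (W := lambdaOrbit x)
      (fun a w hw => lambda_mem_lambdaOrbit a hw) (fun w hw y z => ?_) (g := a)
      (hgen ▸ AddSubgroup.mem_top a) y z
    have := f_act ⟨w, hw⟩
    rw [this, this]
    exact (hs.bijective_sigma (f ⟨w, hw⟩)).injective.eq_iff
  -- the kernel of the action on `Y`
  let N : Subgroup B :=
    { carrier := {a | ∀ y, f (act a y) = f y}
      mul_mem' := fun {a b} ha hb y => by rw [act_mul, ha, hb]
      one_mem' := fun y => by rw [act_one]
      inv_mem' := fun {a} ha y => by rw [← ha (act a⁻¹ y), act_act_inv] }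
  have hN {y z : lambdaOrbit x} (h : f y = f z) : (y : B)⁻¹ * z ∈ N := fun w => by
    rw [act_mul, ← hS (y : B), act_act_inv, f_act, f_act, h]
  let W : Set B := {w | ∃ y z : lambdaOrbit x, f y = f z ∧ w = z - y}
  have hWlam : ∀ a, ∀ w ∈ W, lambda a w ∈ W := by
    rintro a _ ⟨y, z, h, rfl⟩
    exact ⟨act a y, act a z, (hS a y z).2 h, map_sub _ _ _⟩
  have hWN : ∀ w ∈ W, w ∈ N := by
    rintro _ ⟨y, z, h, rfl⟩
    -- With `a = (-y)⁻¹ = lambda a y`, the orbit points `a` and `lambda a z` share a fibre, and `a⁻¹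
    -- * lambda a z = z - y`.
    have hx : (-(y : B))⁻¹ ∈ lambdaOrbit x := by
      rw [← lambda_neg_inv_neg]
      exact lambda_mem_lambdaOrbit _ y.2
    have h' : f ⟨_, hx⟩ = f (act (-(y : B))⁻¹ z) := by
      rw [← (hS (-(y : B))⁻¹ y z).2 h]
      exact congrArg f (Subtype.ext (lambda_neg_inv_neg (y : B)).symm)
    have hmem := hN h'
    dsimp only [act] at hmem
    rwa [inv_mul_lambda, inv_inv, neg_add_eq_sub] at hmem
  have hIlam : ∀ a, ∀ b ∈ AddSubgroup.closure W, lambda a b ∈ AddSubgroup.closure W := by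
    intro a b hb
    induction hb using AddSubgroup.closure_induction with
    | mem w hw => exact AddSubgroup.subset_closure (hWlam a w hw)
    | zero => rw [map_zero]; exact zero_mem _
    | add g h _ _ ihg ihh => rw [map_add]; exact add_mem ihg ihh
    | neg g _ ih => rw [map_neg]; exact neg_mem ih
  -- Such `g` preserves each fibre of `f`, so for `c` in the orbit the difference is itself in `W`.
  have hIsub {g : B} (hg : g ∈ AddSubgroup.closure W) (c : B) :
      lambda g c - c ∈ AddSubgroup.closure W := by
    have hgN := addClosure_subset_subgroup hWlam hWN hg
    have hc : c ∈ AddSubgroup.closure (lambdaOrbit x) := hgen ▸ AddSubgroup.mem_top c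
    induction hc using AddSubgroup.closure_induction with
    | mem w hw =>
      exact AddSubgroup.subset_closure ⟨⟨w, hw⟩, act g ⟨w, hw⟩, (hgN ⟨w, hw⟩).symm, rfl⟩
    | zero => rw [map_zero, sub_zero]; exact zero_mem _
    | add c d _ _ ihc ihd => rw [map_add, add_sub_add_comm]; exact add_mem ihc ihd
    | neg c _ ih => rw [map_neg, ← neg_sub']; exact neg_mem ih
  have hI : IsIdeal (subgroupOfInvariant (AddSubgroup.closure W) hIlam) := by
    refine ⟨⟨fun g hg a => ?_⟩, hIlam⟩
    rw [conj_eq]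
    exact AddSubgroup.sub_mem _ (hIlam a g hg) (hIlam a _ (hIsub hg _))
  rcases hB.2 _ hI with h | h
  · refine Or.inl ⟨fun y z hyz => ?_, hsurj⟩
    have hm : (z : B) - y ∈ subgroupOfInvariant (AddSubgroup.closure W) hIlam :=
      AddSubgroup.subset_closure (show (z : B) - y ∈ W from ⟨y, z, hyz, rfl⟩)
    rw [h, Subgroup.mem_bot, one_eq_zero, sub_eq_zero] at hm
    exact Subtype.ext hm.symm
  · refine Or.inr ?_
    have hconst (y : lambdaOrbit x) : f y = f ⟨x, self_mem_lambdaOrbit x⟩ := by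
      obtain ⟨y, a, rfl⟩ := y
      have ha : a ∈ subgroupOfInvariant (AddSubgroup.closure W) hIlam := h ▸ Subgroup.mem_top a
      exact addClosure_subset_subgroup hWlam hWN ha ⟨x, self_mem_lambdaOrbit x⟩
    rw [Nat.card_eq_one_iff_unique]
    refine ⟨⟨fun y z => ?_⟩, hs.nonempty⟩
    obtain ⟨y, rfl⟩ := hsurj y
    obtain ⟨z, rfl⟩ := hsurj z
    rw [hconst, hconst z]

end LeftBrace

/-! ### The companion matrix as a cyclic shift, and the invariant form -/

namespace CyclicConstruction

open Matrix

variable {q : ℕ} {F : Type*} [CommRing F]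

/-- The extension of a vector of length `q - 1` to `ZMod q` by the value `0` at `-1`. Up to
constants, the companion matrix `matC` acts on these extensions as the cyclic shift. -/
def extend (w : Fin (q - 1) → F) (t : ZMod q) : F :=
  if h : t.val < q - 1 then w ⟨t.val, h⟩ else 0

theorem extend_natCast (w : Fin (q - 1) → F) (i : Fin (q - 1)) :
    extend w ((i : ℕ) : ZMod q) = w i := by
  have h : ((i : ℕ) : ZMod q).val = i := ZMod.val_natCast_of_lt (by omega)
  simp [extend, h]

theorem extend_add (v w : Fin (q - 1) → F) (t : ZMod q) :
    extend (v + w) t = extend v t + extend w t := by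
  unfold extend
  split_ifs <;> simp

theorem extend_injective : Function.Injective (extend : (Fin (q - 1) → F) → ZMod q → F) := by
  intro v w h
  funext i
  rw [← extend_natCast v, h, extend_natCast]

theorem val_lt_or_eq_neg_one [NeZero q] (t : ZMod q) : t.val < q - 1 ∨ t = -1 := by
  have h := ZMod.val_lt t
  by_cases h' : t.val < q - 1
  · exact Or.inl h'
  · right
    have e : t.val + 1 = q := by omega
    have : ((t.val + 1 : ℕ) : ZMod q) = 0 := by rw [e, ZMod.natCast_self]
    rw [Nat.cast_add, ZMod.natCast_zmod_val, Nat.cast_one] at this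
    exact eq_neg_of_add_eq_zero_left this

theorem extend_neg_one [NeZero q] (w : Fin (q - 1) → F) : extend w (-1) = 0 := by
  obtain ⟨m, rfl⟩ := Nat.exists_eq_succ_of_ne_zero (NeZero.ne q)
  simp [extend, ZMod.val_neg_one]

/-- The cyclic shift by `k`, normalized to vanish at `-1`. -/
def shift (k : ZMod q) (w : Fin (q - 1) → F) : Fin (q - 1) → F :=
  fun i => extend w ((i : ℕ) - k) - extend w (-1 - k)

theorem extend_shift [NeZero q] (k : ZMod q) (w : Fin (q - 1) → F) (t : ZMod q) :
    extend (shift k w) t = extend w (t - k) - extend w (-1 - k) := by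
  rcases val_lt_or_eq_neg_one t with h | rfl
  · have := extend_natCast (shift k w) ⟨t.val, h⟩
    rw [ZMod.natCast_zmod_val] at this
    rw [this, shift, ZMod.natCast_zmod_val]
  · rw [extend_neg_one, sub_self]

theorem shift_zero [NeZero q] (w : Fin (q - 1) → F) : shift 0 w = w := by
  apply extend_injective
  funext t
  rw [extend_shift, sub_zero, sub_zero, extend_neg_one, sub_zero]

theorem shift_shift [NeZero q] (k l : ZMod q) (w : Fin (q - 1) → F) :
    shift k (shift l w) = shift (k + l) w := by
  apply extend_injective
  funext t
  rw [extend_shift, extend_shift, extend_shift, extend_shift, sub_sub_sub_cancel_right,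
    sub_sub, sub_sub]

theorem shift_vec_add (k : ZMod q) (v w : Fin (q - 1) → F) :
    shift k (v + w) = shift k v + shift k w := by
  funext i
  simp only [shift, extend_add, Pi.add_apply]
  ring

/-- Entry `i` of the product is `w (i - 1) - w (q - 2)`, the first term being `0` for `i = 0`; in
`ZMod q` the last index `q - 2` is `-1 - 1`. -/
theorem matC_mulVec [Fact (1 < q)] (w : Fin (q - 1) → F) :
    matC F q *ᵥ w = shift 1 w := by
  have hq : 1 < q := Fact.out
  have : NeZero q := ⟨by omega⟩
  have hlast : extend w (-1 - 1) = w ⟨q - 2, by omega⟩ := by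
    rw [← extend_natCast w ⟨q - 2, by omega⟩]
    congr 1
    push_cast [Nat.cast_sub (show 2 ≤ q by omega)]
    simp; ring
  funext i
  have hsplit (j : Fin (q - 1)) : matC F q i j * w j =
      (if (i : ℕ) = (j : ℕ) + 1 then w j else 0) -
        (if j = ⟨q - 2, by omega⟩ then w j else 0) := by
    have := i.2
    have := j.2
    have hj : j = ⟨q - 2, by omega⟩ ↔ (j : ℕ) + 1 = q - 1 := by
      rw [Fin.ext_iff]; dsimp only; omega
    simp only [hj, matC]
    split_ifs <;> first | omega | simp
  have hprev : (∑ j : Fin (q - 1), if (i : ℕ) = (j : ℕ) + 1 then w j else 0) =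
      extend w ((i : ℕ) - 1) := by
    rcases Nat.eq_zero_or_pos (i : ℕ) with h0 | hpos
    · rw [h0, Nat.cast_zero, zero_sub, extend_neg_one]
      exact Finset.sum_eq_zero fun j _ => if_neg (by omega)
    · have hlt : (i : ℕ) - 1 < q - 1 := by omega
      rw [Finset.sum_eq_single ⟨(i : ℕ) - 1, hlt⟩]
      · rw [if_pos (by dsimp only; omega), ← extend_natCast w ⟨(i : ℕ) - 1, hlt⟩]
        dsimp only
        rw [Nat.cast_sub hpos, Nat.cast_one]
      · intro j _ hj
        refine if_neg fun h => hj (Fin.ext ?_)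
        dsimp only; omega
      · simp
  rw [mulVec, dotProduct, Finset.sum_congr rfl fun j _ => hsplit j, Finset.sum_sub_distrib, hprev,
    Finset.sum_ite_eq' Finset.univ, if_pos (Finset.mem_univ _), shift, hlast]

theorem matC_pow_mulVec [Fact (1 < q)] (m : ℕ) (w : Fin (q - 1) → F) :
    (matC F q ^ m) *ᵥ w = shift (m : ZMod q) w := by
  have : NeZero q := ⟨by have : 1 < q := Fact.out; omega⟩
  induction m with
  | zero => rw [pow_zero, one_mulVec, Nat.cast_zero, shift_zero]
  | succ m ih =>
    rw [pow_succ', ← mulVec_mulVec, ih, matC_mulVec, shift_shift, Nat.cast_succ, add_comm]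

/-- The extended all-ones vector vanishes only at `-1`. The shift moves this zero to `j`, and
normalizing at `-1` subtracts `1` everywhere. -/
theorem shift_const_one [NeZero q] (j : Fin (q - 1)) :
    shift (((j : ℕ) : ZMod q) + 1) (fun _ => 1 : Fin (q - 1) → F) = -Pi.single j 1 := by
  have hext (t : ZMod q) : extend (fun _ => 1 : Fin (q - 1) → F) t = if t = -1 then 0 else 1 := by
    split_ifs with h
    · rw [h, extend_neg_one]
    · rw [extend, dif_pos ((val_lt_or_eq_neg_one t).resolve_right h)]
  have hcast (i : Fin (q - 1)) : ((i : ℕ) : ZMod q) = (j : ℕ) ↔ i = j := by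
    refine ⟨fun h => Fin.ext ?_, fun h => by rw [h]⟩
    have := congrArg ZMod.val h
    rwa [ZMod.val_natCast_of_lt (by omega), ZMod.val_natCast_of_lt (by omega)] at this
  have hj : (j : ZMod q) + 1 ≠ 0 := fun h => by
    -- Coefficients in `ℤ`, since `F` may be the zero ring.
    have h' : extend (fun _ => 1 : Fin (q - 1) → ℤ) (-1) = 1 := by
      rw [← eq_neg_of_add_eq_zero_left h, extend_natCast]
    rw [extend_neg_one] at h'
    exact zero_ne_one h'
  funext i
  have hi : ((i : ℕ) : ZMod q) - ((j : ℕ) + 1) = -1 ↔ i = j := by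
    rw [← hcast i, sub_eq_iff_eq_add, neg_add_cancel_comm_assoc]
  have hne : (-1 : ZMod q) - ((j : ℕ) + 1) ≠ -1 := fun h => hj (sub_eq_self.1 h)
  rw [shift, hext, hext, if_neg hne, Pi.neg_apply, Pi.single_apply]
  simp only [hi]
  split_ifs <;> simp

theorem sum_single_add_one (hq : 1 ≤ q) :
    ∑ j : Fin (q - 1), (Pi.single j 1 + fun _ => 1) = fun _ => (q : F) := by
  funext k
  simp [Finset.sum_add_distrib, Finset.sum_apply, Nat.cast_sub hq, Pi.single_apply]

/-- The symmetric bilinear form with matrix `matB`. -/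
def bform (v w : Fin (q - 1) → F) : F := v ⬝ᵥ (matB F q *ᵥ w)

theorem matB_mulVec (w : Fin (q - 1) → F) (i : Fin (q - 1)) :
    (matB F q *ᵥ w) i = ∑ j, w j - q * w i := by
  have h (j : Fin (q - 1)) : matB F q i j * w j = w j - if i = j then q * w j else 0 := by
    unfold matB
    split_ifs <;> ring
  rw [mulVec, dotProduct, Finset.sum_congr rfl fun j _ => h j, Finset.sum_sub_distrib,
    Finset.sum_ite_eq Finset.univ, if_pos (Finset.mem_univ _)]

theorem bform_eq_sum (v w : Fin (q - 1) → F) :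
    bform v w = (∑ i, v i) * ∑ i, w i - q * ∑ i, v i * w i := by
  simp only [bform, dotProduct, matB_mulVec, mul_sub, Finset.sum_sub_distrib, Finset.sum_mul]
  simp only [Finset.mul_sum, mul_left_comm]

theorem sum_zmod_eq [NeZero q] (f : ZMod q → F) (hf : f (-1) = 0) :
    ∑ t, f t = ∑ i : Fin (q - 1), f ((i : ℕ) : ZMod q) := by
  symm
  apply Finset.sum_of_injOn (fun i : Fin (q - 1) => ((i : ℕ) : ZMod q))
  · intro i _ j _ h
    have := congrArg ZMod.val h
    dsimp only at this
    rw [ZMod.val_natCast_of_lt (by omega), ZMod.val_natCast_of_lt (by omega)] at this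
    exact Fin.ext this
  · simp
  · intro t _ ht
    rcases val_lt_or_eq_neg_one t with h | rfl
    · exact absurd ⟨⟨t.val, h⟩, by simp⟩ ht
    · exact hf
  · simp

theorem bform_eq_sum_extend [NeZero q] (v w : Fin (q - 1) → F) :
    bform v w =
      (∑ t, extend v t) * ∑ t, extend w t - q * ∑ t, extend v t * extend w t := by
  rw [bform_eq_sum, sum_zmod_eq _ (extend_neg_one v), sum_zmod_eq _ (extend_neg_one w),
    sum_zmod_eq (fun t => extend v t * extend w t) (by rw [extend_neg_one, zero_mul])]
  simp only [extend_natCast]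

/-- Translation preserves sums over `ZMod q`, and the normalizing constants cancel because `ZMod q`
has `q` elements. -/
theorem bform_shift [NeZero q] (k : ZMod q) (v w : Fin (q - 1) → F) :
    bform (shift k v) (shift k w) = bform v w := by
  have hs (g : ZMod q → F) : ∑ t, g (t - k) = ∑ t, g t :=
    Equiv.sum_comp (Equiv.subRight k) g
  simp only [bform_eq_sum_extend, extend_shift, sub_mul, mul_sub, Finset.sum_sub_distrib,
    ← Finset.sum_mul, ← Finset.mul_sum, hs, hs fun t => extend v t * extend w t,
    Finset.sum_const, Finset.card_univ, ZMod.card, nsmul_eq_mul]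
  ring

theorem bform_comm (v w : Fin (q - 1) → F) : bform v w = bform w v := by
  rw [bform_eq_sum, bform_eq_sum, mul_comm]
  simp only [mul_comm]

theorem bform_add_left (u v w : Fin (q - 1) → F) : bform (u + v) w = bform u w + bform v w :=
  add_dotProduct _ _ _

theorem bform_add_right (u v w : Fin (q - 1) → F) : bform u (v + w) = bform u v + bform u w := by
  rw [bform_comm, bform_add_left, bform_comm v, bform_comm w]

variable {K : Type*} [Field K]

/-- A kernel vector of `matB` has `q * w i = ∑ w` for all `i`; summing over the `q - 1` indices
gives `∑ w = 0`, so `w = 0`. -/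
theorem bform_surjective (hq : (q : K) ≠ 0) {w : Fin (q - 1) → K} (hw : w ≠ 0) (c : K) :
    ∃ v, bform v w = c := by
  have hne : matB K q *ᵥ w ≠ 0 := by
    intro h
    apply hw
    have hi (i : Fin (q - 1)) : (q : K) * w i = ∑ j, w j := by
      have := congrFun h i
      rw [matB_mulVec, Pi.zero_apply, sub_eq_zero] at this
      exact this.symm
    have hsum : (q : K) * ∑ j, w j = ((q - 1 : ℕ) : K) * ∑ j, w j := by
      rw [Finset.mul_sum, Finset.sum_congr rfl fun i _ => hi i, Finset.sum_const,
        Finset.card_univ, Fintype.card_fin, nsmul_eq_mul]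
    have hq0 : 1 ≤ q := Nat.one_le_iff_ne_zero.2 fun h => hq (by rw [h, Nat.cast_zero])
    have h0 : ∑ j, w j = 0 := by
      rw [Nat.cast_sub hq0, Nat.cast_one] at hsum
      linear_combination hsum
    funext i
    have := hi i
    rw [h0] at this
    exact (mul_eq_zero.1 this).resolve_left hq
  obtain ⟨i, hi⟩ := Function.ne_iff.1 hne
  refine ⟨Pi.single i (c / (matB K q *ᵥ w) i), ?_⟩
  rw [bform, single_dotProduct]
  exact div_mul_cancel₀ c hi

/-- Each step by `-k` adds the same constant to the extension. After `q` steps the total is `0`, so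
the constant is `0`, and multiples of `k` exhaust `ZMod q`. -/
theorem eq_zero_of_shift_eq [Fact q.Prime] (hq : (q : K) ≠ 0) {k : ZMod q} (hk : k ≠ 0)
    {w : Fin (q - 1) → K} (h : shift k w = w) : w = 0 := by
  have ht (t : ZMod q) : extend w t = extend w (t - k) - extend w (-1 - k) := by
    rw [← extend_shift, h]
  have hm (m : ℕ) : extend w (-1 - m * k) = m * extend w (-1 - k) := by
    induction m with
    | zero => simp [extend_neg_one]
    | succ m ih =>
      have := ht (-1 - m * k)
      rw [ih] at this
      rw [Nat.cast_succ, Nat.cast_succ, add_mul, add_mul, one_mul, one_mul, ← sub_sub]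
      linear_combination -this
  have h0 : extend w (-1 - k) = 0 := by
    have := hm q
    rw [ZMod.natCast_self, zero_mul, sub_zero, extend_neg_one] at this
    exact (mul_eq_zero.1 this.symm).resolve_left hq
  apply extend_injective
  funext t
  have := hm ((-1 - t) / k).val
  rw [ZMod.natCast_zmod_val, div_mul_cancel₀ _ hk, sub_sub_cancel, h0, mul_zero] at this
  rw [this]
  simp [extend]

end CyclicConstruction

/-! ### Ideals of asymmetric products -/

namespace AsymmetricProduct

open LeftBrace

variable {T H : Type*} [AddCommGroup T] [AddCommGroup H] {D : AsymmetricData T H}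

theorem lambda_mk (u v : T) (x y : H) :
    lambda (⟨u, x⟩ : AsymmetricProduct D) ⟨v, y⟩ =
      ⟨D.act x v, y - D.form u (D.act x v)⟩ := by
  rw [lambda_apply, mul_def, neg_def, add_def]
  ext
  · exact neg_add_cancel_left _ _
  · simp only [map_neg, map_add, AddMonoidHom.neg_apply]
    abel

/-- The projection of an asymmetric product onto its first factor. -/
def fstHom (D : AsymmetricData T H) : AsymmetricProduct D →+ T where
  toFun := fst
  map_zero' := rfl
  map_add' _ _ := rfl

/-- The underlying set of an asymmetric product is `T × H`. -/
def equivProd (D : AsymmetricData T H) : AsymmetricProduct D ≃ T × H where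
  toFun a := (a.fst, a.snd)
  invFun a := ⟨a.1, a.2⟩

/-- `lambda (u, 0)` changes `(v, y)` only by `-form u v` in the second coordinate; take the
quotient. -/
theorem mk_zero_form_mem {I : Subgroup (AsymmetricProduct D)} (hI : IsIdeal I) {v : T} {y : H}
    (h : ⟨v, y⟩ ∈ I) (u : T) : ⟨0, D.form u v⟩ ∈ I := by
  have h' := hI.2 ⟨u, 0⟩ _ h
  have h'' := I.mul_mem (I.inv_mem h') h
  rw [lambda_mk, inv_def, mul_def, map_zero] at h''
  convert h'' using 2 <;> simp

/-- This is the commutator of `(w, 0)` and `(0, y)`. -/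
theorem mk_sub_act_mem {I : Subgroup (AsymmetricProduct D)} (hI : IsIdeal I) {y : H}
    (h : ⟨0, y⟩ ∈ I) (w : T) : ⟨w - D.act y w, 0⟩ ∈ I := by
  have h' := I.mul_mem (hI.1.conj_mem _ h ⟨w, 0⟩) (I.inv_mem h)
  simp only [inv_def, mul_def] at h'
  convert h' using 2 <;> simp [sub_eq_add_neg]

/-- The intersection of a multiplicative subgroup with the first factor. -/
def fstSubgroup (I : Subgroup (AsymmetricProduct D)) : AddSubgroup T where
  carrier := {u | (⟨u, 0⟩ : AsymmetricProduct D) ∈ I}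
  zero_mem' := I.one_mem
  add_mem' {u v} hu hv := by
    have := I.mul_mem hu hv
    simpa [mul_def] using this
  neg_mem' {u} hu := by
    have := I.inv_mem hu
    simpa [inv_def] using this

/-- The intersection of a multiplicative subgroup with the second factor. -/
def sndSubgroup (I : Subgroup (AsymmetricProduct D)) : AddSubgroup H where
  carrier := {x | (⟨0, x⟩ : AsymmetricProduct D) ∈ I}
  zero_mem' := I.one_mem
  add_mem' {u v} hu hv := by
    have := I.mul_mem hu hv
    simpa [mul_def] using this
  neg_mem' {u} hu := by
    have := I.inv_mem hu
    simpa [inv_def] using this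

theorem mem_fstSubgroup {I : Subgroup (AsymmetricProduct D)} {u : T} :
    u ∈ fstSubgroup I ↔ ⟨u, 0⟩ ∈ I := Iff.rfl

theorem mem_sndSubgroup {I : Subgroup (AsymmetricProduct D)} {x : H} :
    x ∈ sndSubgroup I ↔ ⟨0, x⟩ ∈ I := Iff.rfl

theorem eq_top_of_factors {I : Subgroup (AsymmetricProduct D)} (h₁ : ∀ u, u ∈ fstSubgroup I)
    (h₂ : ∀ x, x ∈ sndSubgroup I) : I = ⊤ := by
  rw [Subgroup.eq_top_iff']
  rintro ⟨u, x⟩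
  have := I.mul_mem (h₁ u) (h₂ x)
  simpa [mul_def] using this

end AsymmetricProduct

theorem AddSubgroup.mem_of_single_mem {ι : Type*} [Fintype ι] [DecidableEq ι] {M : ι → Type*}
    [∀ i, AddCommGroup (M i)] {S : AddSubgroup (∀ i, M i)} (h : ∀ i m, Pi.single i m ∈ S)
    (f : ∀ i, M i) : f ∈ S := by
  rw [← Finset.univ_sum_single f]
  exact sum_mem fun i _ => h i _

/-! ### The cyclic brace: order, simplicity and a generating orbit -/

namespace CyclicConstruction

open LeftBrace AsymmetricProduct

theorem card_H {n : ℕ} (p : Fin n → ℕ) : Nat.card (H p) = ∏ i, p i := by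
  rw [Nat.card_pi]
  exact Finset.prod_congr rfl fun i _ => Nat.card_zmod (p i)

variable {n : ℕ} (p : Fin n → ℕ) [∀ i, Fact (p i).Prime]

/-- The action of `H p` on `T p` by componentwise cyclic shifts, and the componentwise forms. -/
def cyclicData : AsymmetricData (T p) (H p) where
  act :=
    { toFun := fun x =>
        { toFun := fun u i => shift (x (finRotate n i)) (u i)
          invFun := fun u i => shift (-x (finRotate n i)) (u i)
          left_inv := fun u => by
            funext i
            dsimp only
            rw [shift_shift, neg_add_cancel, shift_zero]
          right_inv := fun u => by
            funext i
            dsimp only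
            rw [shift_shift, add_neg_cancel, shift_zero]
          map_add' := fun u v => funext fun i => shift_vec_add _ (u i) (v i) }
      map_zero' := by
        ext u i : 2
        exact shift_zero (u i)
      map_add' := fun x y => by
        ext u i : 2
        exact (shift_shift _ _ (u i)).symm }
  form := AddMonoidHom.mk' (fun u => AddMonoidHom.mk' (fun v i => bform (u i) (v i))
      fun v w => funext fun i => bform_add_right (u i) (v i) (w i))
    fun u v => AddMonoidHom.ext fun w => funext fun i => bform_add_left (u i) (v i) (w i)
  form_symm u v := funext fun i => bform_comm (u i) (v i)
  form_act x u v := funext fun i => bform_shift _ (u i) (v i)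

theorem cyclicData_act_apply (x : H p) (u : T p) (i : Fin n) :
    (cyclicData p).act x u i = shift (x (finRotate n i)) (u i) := rfl

theorem cyclicData_form_apply (u v : T p) (i : Fin n) :
    (cyclicData p).form u v i = bform (u i) (v i) := rfl

instance : Finite (AsymmetricProduct (cyclicData p)) :=
  Finite.of_equiv _ (equivProd (cyclicData p)).symm

theorem card_cyclicProduct :
    Nat.card (AsymmetricProduct (cyclicData p)) = ∏ i, p i ^ p (finRotate n i) := by
  rw [Nat.card_congr (equivProd (cyclicData p)), Nat.card_prod, card_H, Nat.card_pi,
    ← Finset.prod_mul_distrib]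
  refine Finset.prod_congr rfl fun i _ => ?_
  rw [Nat.card_fun, Nat.card_zmod, Nat.card_fin, ← pow_succ,
    Nat.sub_add_cancel (Fact.out : (p (finRotate n i)).Prime).one_le]

variable {p}

theorem const_one_ne_zero (i : Fin n) :
    (fun _ => 1 : Fin (p (finRotate n i) - 1) → ZMod (p i)) ≠ 0 := by
  have h := (Fact.out : (p (finRotate n i)).Prime).one_lt
  exact fun h' => one_ne_zero (congrFun h' ⟨0, by omega⟩)

theorem act_ne_zero {u : T p} (hu : ∀ i, u i ≠ 0) (x : H p) (i : Fin n) :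
    (cyclicData p).act x u i ≠ 0 := by
  intro h
  rw [cyclicData_act_apply] at h
  apply hu i
  have h0 : shift (-x (finRotate n i)) (shift (x (finRotate n i)) (u i)) = 0 := by
    rw [h]
    funext j
    simp [shift, extend]
  rwa [shift_shift, neg_add_cancel, shift_zero] at h0

section

variable (hq : ∀ i, ((p (finRotate n i) : ℕ) : ZMod (p i)) ≠ 0)
include hq

theorem form_surjective {v : T p} (hv : ∀ i, v i ≠ 0) (z : H p) :
    ∃ u, (cyclicData p).form u v = z := by
  choose u hu using fun i => bform_surjective (hq i) (hv i) (z i)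
  exact ⟨u, funext hu⟩

theorem act_injective {v : T p} (hv : ∀ i, v i ≠ 0) :
    Function.Injective fun x => (cyclicData p).act x v := by
  intro x y h
  funext j
  obtain ⟨i, rfl⟩ := (finRotate n).surjective j
  have hi := congrFun h i
  dsimp only at hi
  rw [cyclicData_act_apply, cyclicData_act_apply] at hi
  by_contra hne
  apply hv i
  refine eq_zero_of_shift_eq (hq i) (k := -y (finRotate n i) + x (finRotate n i)) ?_ ?_
  · rwa [Ne, neg_add_eq_sub, sub_eq_zero]
  · rw [← shift_shift, hi, shift_shift, neg_add_cancel, shift_zero]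

/-- Without nonzero fixed vectors, `1 - shift` is injective, hence onto a finite group. -/
theorem exists_sub_shift_eq (i : Fin n) (w : Fin (p (finRotate n i) - 1) → ZMod (p i)) :
    ∃ v, v - shift 1 v = w := by
  let φ : (Fin (p (finRotate n i) - 1) → ZMod (p i)) →+
      (Fin (p (finRotate n i) - 1) → ZMod (p i)) :=
    AddMonoidHom.mk' (fun v => v - shift 1 v) fun u v => by rw [shift_vec_add]; abel
  have hφ : Function.Injective φ := by
    rw [injective_iff_map_eq_zero]
    intro v hv
    exact eq_zero_of_shift_eq (hq i) one_ne_zero (sub_eq_zero.1 hv).symm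
  exact Finite.injective_iff_surjective.1 hφ w

theorem not_isTrivial_cyclicProduct (i : Fin n) :
    ¬ IsTrivial (AsymmetricProduct (cyclicData p)) := by
  intro h
  obtain ⟨u, hu⟩ := form_surjective hq (v := fun i _ => 1) const_one_ne_zero 1
  have h' := congrArg AsymmetricProduct.snd
    (h (⟨u, 0⟩ : AsymmetricProduct (cyclicData p)) ⟨fun i _ => 1, 0⟩)
  simp only [mul_def, AsymmetricProduct.add_def, hu, add_zero, zero_add] at h'
  exact zero_ne_one (congrFun h' i)

section Ideal

variable {I : Subgroup (AsymmetricProduct (cyclicData p))} (hI : IsIdeal I)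
include hI

theorem single_mem_sndSubgroup {v : T p} {y : H p} (h : ⟨v, y⟩ ∈ I) {i : Fin n} (hv : v i ≠ 0)
    (z : ZMod (p i)) : Pi.single i z ∈ sndSubgroup I := by
  obtain ⟨u, hu⟩ := bform_surjective (hq i) hv z
  have h' := mk_zero_form_mem hI h (Pi.single i u)
  rw [mem_sndSubgroup]
  convert h' using 2
  funext j
  rw [cyclicData_form_apply]
  rcases eq_or_ne j i with rfl | hj
  · rw [Pi.single_eq_same, Pi.single_eq_same, hu]
  · rw [Pi.single_eq_of_ne hj, Pi.single_eq_of_ne hj, bform, zero_dotProduct]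

theorem single_mem_fstSubgroup {i : Fin n}
    (h : ∀ z, Pi.single (finRotate n i) z ∈ sndSubgroup I)
    (w : Fin (p (finRotate n i) - 1) → ZMod (p i)) : Pi.single i w ∈ fstSubgroup I := by
  obtain ⟨v, rfl⟩ := exists_sub_shift_eq hq i w
  have h' := mk_sub_act_mem hI (h 1) (Pi.single i v)
  rw [mem_fstSubgroup]
  convert h' using 2
  funext j
  rw [Pi.sub_apply, cyclicData_act_apply]
  rcases eq_or_ne j i with rfl | hj
  · rw [Pi.single_eq_same, Pi.single_eq_same, Pi.single_eq_same]
  · have hj' : finRotate n j ≠ finRotate n i := (finRotate n).injective.ne hj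
    rw [Pi.single_eq_of_ne hj, Pi.single_eq_of_ne hj, Pi.single_eq_of_ne hj', shift_zero, sub_zero]

theorem exists_single_mem_sndSubgroup (hI' : I ≠ ⊥) :
    ∃ i, ∀ z, Pi.single i z ∈ sndSubgroup I := by
  obtain ⟨⟨⟨v, y⟩, hmem⟩, hne⟩ := Subgroup.ne_bot_iff_exists_ne_one.1 hI'
  by_cases hv : v = 0
  · subst hv
    have hy : y ≠ 0 := fun hy => hne (by subst hy; rfl)
    obtain ⟨j, hj⟩ := Function.ne_iff.1 hy
    obtain ⟨i, rfl⟩ := (finRotate n).surjective j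
    refine ⟨i, single_mem_sndSubgroup hq hI (mk_sub_act_mem hI hmem fun _ _ => 1) ?_⟩
    rw [Pi.sub_apply, cyclicData_act_apply, Ne, sub_eq_zero]
    exact fun h => const_one_ne_zero i (eq_zero_of_shift_eq (hq i) hj h.symm)
  · obtain ⟨i, hi⟩ := Function.ne_iff.1 hv
    exact ⟨i, single_mem_sndSubgroup hq hI hmem hi⟩

end Ideal

theorem isSimple_cyclicProduct (hn : 1 < n) : IsSimple (AsymmetricProduct (cyclicData p)) := by
  have hfix (i : Fin n) : finRotate n i ≠ i := by
    rw [← Equiv.Perm.mem_support, support_finRotate_of_le hn]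
    exact Finset.mem_univ i
  refine ⟨⟨⟨0, 0⟩, ⟨0, 1⟩, fun h => ?_⟩, fun I hI => or_iff_not_imp_left.2 fun hI' => ?_⟩
  · exact zero_ne_one (congrFun (congrArg AsymmetricProduct.snd h) ⟨0, by omega⟩)
  obtain ⟨i, hi⟩ := exists_single_mem_sndSubgroup hq hI hI'
  -- Propagation runs backwards: factor `j + 1` of `H` yields factor `j` of `T`, then factor `j` of
  -- `H`.
  have hback (m : ℕ) : ∀ j, (finRotate n ^ m) j = i → ∀ z, Pi.single j z ∈ sndSubgroup I := by
    induction m with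
    | zero => rintro j rfl; exact hi
    | succ m ih =>
      intro j hj
      have hj' := ih (finRotate n j) (by rw [← hj, pow_succ, Equiv.Perm.mul_apply])
      refine single_mem_sndSubgroup hq hI (single_mem_fstSubgroup hq hI hj' fun _ => 1) ?_
      rw [Pi.single_eq_same]
      exact const_one_ne_zero j
  have hall (j : Fin n) : ∀ z, Pi.single j z ∈ sndSubgroup I := by
    obtain ⟨m, hm⟩ := (isCycle_finRotate_of_le hn).exists_pow_eq (hfix j) (hfix i)
    exact hback m j hm
  exact eq_top_of_factors
    (AddSubgroup.mem_of_single_mem fun j => single_mem_fstSubgroup hq hI (hall _))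
    (AddSubgroup.mem_of_single_mem hall)

/-- Pairing with `α(x) v`, whose components are all nonzero, is onto `H`, so the second coordinate
is arbitrary. -/
theorem mk_act_mem_lambdaOrbit {v : T p} (hv : ∀ i, v i ≠ 0) (x y : H p) :
    (⟨(cyclicData p).act x v, y⟩ : AsymmetricProduct (cyclicData p)) ∈ lambdaOrbit ⟨v, 0⟩ := by
  obtain ⟨u, hu⟩ := form_surjective hq (act_ne_zero hv x) (-y)
  exact ⟨⟨u, x⟩, by rw [lambda_mk, hu, sub_neg_eq_add, zero_add]⟩

theorem lambdaOrbit_eq_range {v : T p} (hv : ∀ i, v i ≠ 0) :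
    lambdaOrbit (⟨v, 0⟩ : AsymmetricProduct (cyclicData p)) =
      Set.range fun x : H p × H p => ⟨(cyclicData p).act x.1 v, x.2⟩ := by
  ext a
  constructor
  · rintro ⟨⟨u, x⟩, rfl⟩
    exact ⟨(x, _), (lambda_mk u v x 0).symm⟩
  · rintro ⟨x, rfl⟩
    exact mk_act_mem_lambdaOrbit hq hv x.1 x.2

theorem card_lambdaOrbit {v : T p} (hv : ∀ i, v i ≠ 0) :
    Nat.card (lambdaOrbit (⟨v, 0⟩ : AsymmetricProduct (cyclicData p))) = ∏ i, p i ^ 2 := by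
  rw [lambdaOrbit_eq_range hq hv, Nat.card_range_of_injective, Nat.card_prod, card_H,
    Finset.prod_pow, sq]
  rintro ⟨x, y⟩ ⟨x', y'⟩ h
  simp only [AsymmetricProduct.mk.injEq] at h
  exact Prod.ext (act_injective hq hv h.1) h.2

theorem closure_lambdaOrbit :
    AddSubgroup.closure
      (lambdaOrbit (⟨fun _ _ => 1, 0⟩ : AsymmetricProduct (cyclicData p))) = ⊤ := by
  set G := AddSubgroup.closure
    (lambdaOrbit (⟨fun _ _ => 1, 0⟩ : AsymmetricProduct (cyclicData p)))
  have hmem (x y : H p) :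
      (⟨(cyclicData p).act x fun _ _ => 1, y⟩ : AsymmetricProduct (cyclicData p)) ∈ G :=
    AddSubgroup.subset_closure (mk_act_mem_lambdaOrbit hq const_one_ne_zero x y)
  have hsnd (y : H p) : (⟨0, y⟩ : AsymmetricProduct (cyclicData p)) ∈ G := by
    have := G.sub_mem (hmem 0 y) (hmem 0 0)
    rw [sub_eq_add_neg, AsymmetricProduct.neg_def, AsymmetricProduct.add_def] at this
    simpa using this
  have hact (x : H p) : (cyclicData p).act x (fun _ _ => 1) ∈ G.map (fstHom _) :=
    ⟨_, hmem x 0, rfl⟩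
  have hfst (u : T p) : u ∈ G.map (fstHom _) := by
    refine AddSubgroup.mem_of_single_mem (fun i w => ?_) u
    let V := (G.map (fstHom _)).comap
      (AddMonoidHom.single (fun i : Fin n => Fin (p (finRotate n i) - 1) → ZMod (p i)) i)
    -- Shifting only component `i` by `j + 1` isolates it in the difference.
    have hV (j) : Pi.single j 1 + (fun _ => 1) ∈ V := by
      have h := (G.map (fstHom _)).sub_mem (hact 0) (hact (Pi.single (finRotate n i) ((j : ℕ) + 1)))
      change Pi.single i _ ∈ G.map (fstHom _)
      convert h using 1
      funext k
      rw [Pi.sub_apply, cyclicData_act_apply, cyclicData_act_apply, Pi.zero_apply, shift_zero]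
      rcases eq_or_ne k i with rfl | hk
      · rw [Pi.single_eq_same, Pi.single_eq_same, shift_const_one, sub_neg_eq_add, add_comm]
      · have hk' : finRotate n k ≠ finRotate n i := (finRotate n).injective.ne hk
        rw [Pi.single_eq_of_ne hk, Pi.single_eq_of_ne hk', shift_zero, sub_self]
    -- The vectors in `hV` sum to `q` times the all-ones vector, and `q` is invertible.
    have hone : (fun _ => 1) ∈ V := by
      have h := ZMod.smul_mem (V.sum_mem fun j (_ : j ∈ Finset.univ) => hV j)
        ((p (finRotate n i) : ZMod (p i))⁻¹)
      convert h using 1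
      rw [sum_single_add_one (Fact.out : (p (finRotate n i)).Prime).one_le]
      funext k
      exact (inv_mul_cancel₀ (hq i)).symm
    change w ∈ V
    refine AddSubgroup.mem_of_single_mem (fun j c => ?_) w
    have h := ZMod.smul_mem (V.sub_mem (hV j) hone) c
    rwa [add_sub_cancel_right, ← Pi.single_smul, smul_eq_mul, mul_one] at h
  rw [AddSubgroup.eq_top_iff']
  rintro ⟨u, y⟩
  obtain ⟨⟨u, y'⟩, hu, rfl⟩ := hfst u
  have := G.add_mem hu (hsnd (y - y'))
  rw [AsymmetricProduct.add_def] at this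
  simpa [fstHom] using this

theorem nontrivial_lambdaOrbit (i : Fin n) {v : T p} (hv : ∀ i, v i ≠ 0) :
    Nontrivial (lambdaOrbit (⟨v, 0⟩ : AsymmetricProduct (cyclicData p))) := by
  refine ⟨⟨_, mk_act_mem_lambdaOrbit hq hv 0 0⟩, ⟨_, mk_act_mem_lambdaOrbit hq hv 0 1⟩, fun h => ?_⟩
  have h' := congrArg (fun a => AsymmetricProduct.snd (Subtype.val a)) h
  exact zero_ne_one (congrFun h' i)

end

end CyclicConstruction

open CyclicConstruction in
theorem theorem5p2 (n : ℕ) (hn : 1 < n) (p : Fin n → ℕ) (hp : ∀ i, (p i).Prime)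
    (hinj : Function.Injective p) :
    ∃ D : AsymmetricData (T p) (H p),
      (∀ (x : H p) (u : T p) (i : Fin n),
        D.act x u i =
          (matC (ZMod (p i)) (p (finRotate n i)) ^ (x (finRotate n i)).val).mulVec (u i)) ∧
      (∀ (u v : T p) (i : Fin n),
        D.form u v i = u i ⬝ᵥ (matB (ZMod (p i)) (p (finRotate n i))).mulVec (v i)) ∧
      Finite (AsymmetricProduct D) ∧
      ¬ LeftBrace.IsTrivial (AsymmetricProduct D) ∧
      LeftBrace.IsSimple (AsymmetricProduct D) ∧
      Nat.card (AsymmetricProduct D) = ∏ i, p i ^ p (finRotate n i) ∧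
      ∃ a : AsymmetricProduct D,
        AddSubgroup.closure (LeftBrace.lambdaOrbit a) = ⊤ ∧
        Nat.card (LeftBrace.lambdaOrbit a) = ∏ i, p i ^ 2 ∧
        YangBaxter.IsSimpleSolution (LeftBrace.orbitMap a) := by
  have (i : Fin n) : Fact (p i).Prime := ⟨hp i⟩
  have (i : Fin n) : Fact (1 < p i) := ⟨(hp i).one_lt⟩
  have hq (i : Fin n) : ((p (finRotate n i) : ℕ) : ZMod (p i)) ≠ 0 := by
    rw [Ne, ZMod.natCast_eq_zero_iff, Nat.prime_dvd_prime_iff_eq (hp _) (hp _)]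
    intro h
    have hi : i ∈ (finRotate n).support := support_finRotate_of_le hn ▸ Finset.mem_univ i
    exact Equiv.Perm.mem_support.1 hi (hinj h.symm)
  have hsimple := isSimple_cyclicProduct hq hn
  refine ⟨cyclicData p, fun x u i => ?_, fun u v i => rfl, inferInstance,
    not_isTrivial_cyclicProduct hq ⟨0, by omega⟩, hsimple, card_cyclicProduct p,
    ⟨fun _ _ => 1, 0⟩, closure_lambdaOrbit hq, card_lambdaOrbit hq const_one_ne_zero,
    LeftBrace.orbitMap_isSimpleSolution hsimple _ (closure_lambdaOrbit hq)
      (nontrivial_lambdaOrbit hq ⟨0, by omega⟩ const_one_ne_zero)⟩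
  rw [matC_pow_mulVec, ZMod.natCast_zmod_val, cyclicData_act_apply]
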